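/- A *PROP* is a strict symmetric monoidal category whose objects are the natural numbers and whose monoidal product is addition on objects (with unit $0$); a *PROP morphism* is a strict symmetric monoidal functor sending $1$ to $1$. A *signature* $\Sigma$ is a family of sets of formal symbols $\sigma\colon m\to n$ $(m,n\in\mathbb N)$, and $F\Sigma$ denotes the free PROP on $\Sigma$; its morphisms are the $\Sigma$-terms, i.e. the formal composites and sums ($+$, the monoidal product) of identities, braidings and symbols, modulo the laws of a strict symmetric monoidal category. If $E$ is a set of equations (ordered pairs of $\Sigma$-terms of the same type), $E$ is itself regarded as a signature, and $\lambda,\rho\colon FE\to F\Sigma$ are the PROP morphisms sending each pair to its first, respectively second, component. A PROP $P$, together with a morphism of $P$ of type $m\to n$ for each symbol $\sigma\colon m\to n$ of $\Sigma$, is *presented by* $(\Sigma,E)$ if the induced PROP morphism $F\Sigma\to P$ is a coequalizer of $\lambda,\rho$ in the category of PROPs. Let $k$ be a field, and let $\mathtt{FinVect}_k$ be the PROP in which a morphism $m\to n$ is a $k$-linear map $k^m\to k^n$, with composition of linear maps, direct sum as monoidal product, and braiding $k^m\oplus k^n\to k^n\oplus k^m$, $(x,y)\mapsto(y,x)$.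 **Theorem.** For any field $k$, the PROP $\mathtt{FinVect}_k$ is presented by the generators * scaling $s_c\colon 1\to 1$, $x\mapsto cx$, for each $c\in k$; * addition $+\colon 2\to 1$, $(x,y)\mapsto x+y$; * zero $0\colon 0\to 1$, the unique linear map $\{0\}\to k$; * duplication $\Delta\colon 1\to 2$, $x\mapsto(x,x)$; * deletion $!\colon 1\to 0$, the unique linear map $k\to\{0\}$; subject to the following equations, for all $b,c\in k$, where $1$ is the identity of the object $1$, $B\colon 2\to2$ is the braiding of the object $1$ with itself, $\mathrm{id}_0$ is the identity of the unit object, $\oplus$ is the monoidal product, and $g\circ f$ means "first $f$, then $g$": * (1)–(3) $\;+\circ(0\oplus 1)=1,\quad +\circ(1\oplus +)=+\circ(+\oplus 1),\quad +\circ B=+$; * (4)–(6) $\;(!\oplus 1)\circ\Delta=1,\quad (1\oplus\Delta)\circ\Delta=(\Delta\oplus 1)\circ\Delta,\quad B\circ\Delta=\Delta$; * (7)–(10) $\;\Delta\circ +=(+\oplus +)\circ(1\oplus B\oplus 1)\circ(\Delta\oplus\Delta),\quad \Delta\circ 0=0\oplus 0,\quad !\circ +=\,!\,\oplus\,!,\quad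 !\circ 0=\mathrm{id}_0$; * (11)–(14) $\;s_{bc}=s_b\circ s_c,\quad s_{b+c}=+\circ(s_b\oplus s_c)\circ\Delta,\quad s_1=1,\quad s_0=0\,\circ\,!$; * (15)–(16) $\;+\circ(s_c\oplus s_c)=s_c\circ +,\quad s_c\circ 0=0$; * (17)–(18) $\;(s_c\oplus s_c)\circ\Delta=\Delta\circ s_c,\quad !\circ s_c=\,!$. -/

import Mathlib

open CategoryTheory CategoryTheory.Limits

universe u

/-- Transport of an element of `H m n` along equalities of the two indices. -/
def recast (H : ℕ → ℕ → Type u) {m m' n n' : ℕ} (hm : m = m') (hn : n = n') (f : H m n) :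
    H m' n' :=
  cast (congrArg₂ H hm hn) f

/-- A PROP: a strict symmetric monoidal category whose objects are the natural numbers and whose
monoidal product is addition on objects (so the unit object is `0`). Composition is written in
diagrammatic order: `comp f g` is "first `f`, then `g`". Strictness means that the associators and
unitors are identities; since `(m + p) + r` and `m + (p + r)` are equal but not definitionally
equal natural numbers, `recast` appears in the laws. -/
structure PROP : Type (u + 1) where
  /-- Morphisms `m ⟶ n`. -/
  Mor : ℕ → ℕ → Type u
  /-- Identity morphisms. -/
  id : ∀ n : ℕ, Mor n n
  /-- Composition, in diagrammatic order. -/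
  comp : ∀ {m n p : ℕ}, Mor m n → Mor n p → Mor m p
  /-- The monoidal product of morphisms. -/
  tensor : ∀ {m n p q : ℕ}, Mor m n → Mor p q → Mor (m + p) (n + q)
  /-- The braiding. -/
  braid : ∀ m n : ℕ, Mor (m + n) (n + m)
  id_comp : ∀ {m n : ℕ} (f : Mor m n), comp (id m) f = f
  comp_id : ∀ {m n : ℕ} (f : Mor m n), comp f (id n) = f
  comp_assoc : ∀ {m n p q : ℕ} (f : Mor m n) (g : Mor n p) (h : Mor p q),
    comp (comp f g) h = comp f (comp g h)
  tensor_id : ∀ m n : ℕ, tensor (id m) (id n) = id (m + n)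
  tensor_comp : ∀ {m n p m' n' p' : ℕ} (f : Mor m n) (g : Mor n p) (f' : Mor m' n')
    (g' : Mor n' p'),
    tensor (comp f g) (comp f' g') = comp (tensor f f') (tensor g g')
  tensor_assoc : ∀ {m n p q r s : ℕ} (f : Mor m n) (g : Mor p q) (h : Mor r s),
    recast Mor (Nat.add_assoc m p r) (Nat.add_assoc n q s) (tensor (tensor f g) h) =
      tensor f (tensor g h)
  unit_tensor : ∀ {m n : ℕ} (f : Mor m n),
    recast Mor (Nat.zero_add m) (Nat.zero_add n) (tensor (id 0) f) = f
  tensor_unit : ∀ {m n : ℕ} (f : Mor m n),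
    recast Mor (Nat.add_zero m) (Nat.add_zero n) (tensor f (id 0)) = f
  braid_natural : ∀ {m n p q : ℕ} (f : Mor m n) (g : Mor p q),
    comp (tensor f g) (braid n q) = comp (braid m p) (tensor g f)
  braid_symm : ∀ m n : ℕ, comp (braid m n) (braid n m) = id (m + n)
  /-- The hexagon identity; the other one follows from it by symmetry. -/
  hexagon : ∀ m n p : ℕ,
    recast Mor (Nat.add_assoc m n p).symm (Nat.add_assoc n p m) (braid m (n + p)) =
      comp (recast Mor rfl (Nat.add_assoc n m p) (tensor (braid m n) (id p)))
        (tensor (id n) (braid m p))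

namespace PROP

/-- A morphism of PROPs: a strict symmetric monoidal functor sending the object `1` to `1`.
Such a functor sends `n = 1 + ⋯ + 1` to `n`, so it is the identity on objects. -/
@[ext]
structure Hom (P Q : PROP.{u}) : Type u where
  /-- The action on morphisms. -/
  map : ∀ {m n : ℕ}, P.Mor m n → Q.Mor m n
  map_id : ∀ n : ℕ, map (P.id n) = Q.id n
  map_comp : ∀ {m n p : ℕ} (f : P.Mor m n) (g : P.Mor n p),
    map (P.comp f g) = Q.comp (map f) (map g)
  map_tensor : ∀ {m n p q : ℕ} (f : P.Mor m n) (g : P.Mor p q),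
    map (P.tensor f g) = Q.tensor (map f) (map g)
  map_braid : ∀ m n : ℕ, map (P.braid m n) = Q.braid m n

/-- The category of PROPs. -/
instance : Category PROP.{u} where
  Hom P Q := Hom P Q
  id P :=
    { map := fun f => f
      map_id := fun _ => rfl
      map_comp := fun _ _ => rfl
      map_tensor := fun _ _ => rfl
      map_braid := fun _ _ => rfl }
  comp F G :=
    { map := fun f => G.map (F.map f)
      map_id := fun n => by rw [F.map_id, G.map_id]
      map_comp := fun f g => by rw [F.map_comp, G.map_comp]
      map_tensor := fun f g => by rw [F.map_tensor, G.map_tensor]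
      map_braid := fun m n => by rw [F.map_braid, G.map_braid] }

end PROP

/-- A signature: for each type `(m, n)` a set of formal symbols `m ⟶ n`. -/
abbrev Signature : Type (u + 1) := ℕ → ℕ → Type u

/-- The terms over a signature: formal composites and sums of identities, braidings
and symbols. -/
inductive Term (S : Signature.{u}) : ℕ → ℕ → Type u
  | id (n : ℕ) : Term S n n
  | braid (m n : ℕ) : Term S (m + n) (n + m)
  | gen {m n : ℕ} (s : S m n) : Term S m n
  | comp {m n p : ℕ} (f : Term S m n) (g : Term S n p) : Term S m p
  | tensor {m n p q : ℕ} (f : Term S m n) (g : Term S p q) : Term S (m + p) (n + q)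

/-- The congruence on terms generated by the laws of a strict symmetric monoidal category. -/
inductive Term.Rel (S : Signature.{u}) : ∀ {m n : ℕ}, Term S m n → Term S m n → Prop
  | refl {m n : ℕ} (f : Term S m n) : Rel S f f
  | symm {m n : ℕ} {f g : Term S m n} : Rel S f g → Rel S g f
  | trans {m n : ℕ} {f g h : Term S m n} : Rel S f g → Rel S g h → Rel S f h
  | comp_congr {m n p : ℕ} {f f' : Term S m n} {g g' : Term S n p} :
      Rel S f f' → Rel S g g' → Rel S (f.comp g) (f'.comp g')
  | tensor_congr {m n p q : ℕ} {f f' : Term S m n} {g g' : Term S p q} :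
      Rel S f f' → Rel S g g' → Rel S (f.tensor g) (f'.tensor g')
  | id_comp {m n : ℕ} (f : Term S m n) : Rel S ((Term.id m).comp f) f
  | comp_id {m n : ℕ} (f : Term S m n) : Rel S (f.comp (Term.id n)) f
  | comp_assoc {m n p q : ℕ} (f : Term S m n) (g : Term S n p) (h : Term S p q) :
      Rel S ((f.comp g).comp h) (f.comp (g.comp h))
  | tensor_id (m n : ℕ) : Rel S ((Term.id m).tensor (Term.id n)) (Term.id (m + n))
  | tensor_comp {m n p m' n' p' : ℕ} (f : Term S m n) (g : Term S n p) (f' : Term S m' n')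
      (g' : Term S n' p') :
      Rel S ((f.comp g).tensor (f'.comp g')) ((f.tensor f').comp (g.tensor g'))
  | tensor_assoc {m n p q r s : ℕ} (f : Term S m n) (g : Term S p q) (h : Term S r s) :
      Rel S (recast (Term S) (Nat.add_assoc m p r) (Nat.add_assoc n q s)
        ((f.tensor g).tensor h)) (f.tensor (g.tensor h))
  | unit_tensor {m n : ℕ} (f : Term S m n) :
      Rel S (recast (Term S) (Nat.zero_add m) (Nat.zero_add n) ((Term.id 0).tensor f)) f
  | tensor_unit {m n : ℕ} (f : Term S m n) :
      Rel S (recast (Term S) (Nat.add_zero m) (Nat.add_zero n) (f.tensor (Term.id 0))) f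
  | braid_natural {m n p q : ℕ} (f : Term S m n) (g : Term S p q) :
      Rel S ((f.tensor g).comp (Term.braid n q)) ((Term.braid m p).comp (g.tensor f))
  | braid_symm (m n : ℕ) :
      Rel S ((Term.braid m n).comp (Term.braid n m)) (Term.id (m + n))
  | hexagon (m n p : ℕ) :
      Rel S (recast (Term S) (Nat.add_assoc m n p).symm (Nat.add_assoc n p m)
          (Term.braid m (n + p)))
        ((recast (Term S) rfl (Nat.add_assoc n m p)
          ((Term.braid m n).tensor (Term.id p))).comp
            ((Term.id n).tensor (Term.braid m p)))

/-- Morphisms of the free PROP on a signature: terms modulo the laws of a PROP. -/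
def FreeMor (S : Signature.{u}) (m n : ℕ) : Type u :=
  Quot (fun f g : Term S m n => Term.Rel S f g)

/-- The morphism of the free PROP determined by a term. -/
def FreeMor.mk {S : Signature.{u}} {m n : ℕ} (f : Term S m n) : FreeMor S m n := Quot.mk _ f

theorem FreeMor.sound {S : Signature.{u}} {m n : ℕ} {f g : Term S m n} (h : Term.Rel S f g) :
    FreeMor.mk f = FreeMor.mk g := Quot.sound h

theorem FreeMor.ind {S : Signature.{u}} {m n : ℕ} {p : FreeMor S m n → Prop}
    (h : ∀ f : Term S m n, p (FreeMor.mk f)) (f : FreeMor S m n) : p f := Quot.ind h f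

theorem FreeMor.mk_recast {S : Signature.{u}} {m m' n n' : ℕ} (hm : m = m') (hn : n = n')
    (f : Term S m n) :
    recast (FreeMor S) hm hn (FreeMor.mk f) = FreeMor.mk (recast (Term S) hm hn f) := by
  subst hm hn; rfl

/-- Composition in the free PROP. -/
def FreeMor.comp {S : Signature.{u}} {m n p : ℕ} :
    FreeMor S m n → FreeMor S n p → FreeMor S m p :=
  Quot.map₂ Term.comp (fun f _ _ h => .comp_congr (.refl f) h)
    (fun _ _ g h => .comp_congr h (.refl g))

/-- The monoidal product in the free PROP. -/
def FreeMor.tensor {S : Signature.{u}} {m n p q : ℕ} :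
    FreeMor S m n → FreeMor S p q → FreeMor S (m + p) (n + q) :=
  Quot.map₂ Term.tensor (fun f _ _ h => .tensor_congr (.refl f) h)
    (fun _ _ g h => .tensor_congr h (.refl g))

theorem FreeMor.mk_comp {S : Signature.{u}} {m n p : ℕ} (f : Term S m n) (g : Term S n p) :
    (FreeMor.mk f).comp (FreeMor.mk g) = FreeMor.mk (f.comp g) := rfl

theorem FreeMor.mk_tensor {S : Signature.{u}} {m n p q : ℕ} (f : Term S m n) (g : Term S p q) :
    (FreeMor.mk f).tensor (FreeMor.mk g) = FreeMor.mk (f.tensor g) := rfl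

/-- The free PROP on a signature. -/
def FreePROP (S : Signature.{u}) : PROP.{u} where
  Mor := FreeMor S
  id n := FreeMor.mk (Term.id n)
  comp := FreeMor.comp
  tensor := FreeMor.tensor
  braid m n := FreeMor.mk (Term.braid m n)
  id_comp f := by
    induction f using FreeMor.ind with | h f => exact FreeMor.sound (.id_comp f)
  comp_id f := by
    induction f using FreeMor.ind with | h f => exact FreeMor.sound (.comp_id f)
  comp_assoc f g h := by
    induction f using FreeMor.ind with | h f =>
    induction g using FreeMor.ind with | h g =>
    induction h using FreeMor.ind with | h h => exact FreeMor.sound (.comp_assoc f g h)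
  tensor_id m n := FreeMor.sound (.tensor_id m n)
  tensor_comp f g f' g' := by
    induction f using FreeMor.ind with | h f =>
    induction g using FreeMor.ind with | h g =>
    induction f' using FreeMor.ind with | h f' =>
    induction g' using FreeMor.ind with | h g' =>
    exact FreeMor.sound (.tensor_comp f g f' g')
  tensor_assoc f g h := by
    induction f using FreeMor.ind with | h f =>
    induction g using FreeMor.ind with | h g =>
    induction h using FreeMor.ind with | h h =>
    simp only [FreeMor.mk_tensor, FreeMor.mk_recast]
    exact FreeMor.sound (.tensor_assoc f g h)
  unit_tensor f := by
    induction f using FreeMor.ind with | h f =>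
    simp only [FreeMor.mk_tensor, FreeMor.mk_recast]
    exact FreeMor.sound (.unit_tensor f)
  tensor_unit f := by
    induction f using FreeMor.ind with | h f =>
    simp only [FreeMor.mk_tensor, FreeMor.mk_recast]
    exact FreeMor.sound (.tensor_unit f)
  braid_natural f g := by
    induction f using FreeMor.ind with | h f =>
    induction g using FreeMor.ind with | h g => exact FreeMor.sound (.braid_natural f g)
  braid_symm m n := FreeMor.sound (.braid_symm m n)
  hexagon m n p := by
    simp only [FreeMor.mk_tensor, FreeMor.mk_recast, FreeMor.mk_comp]
    exact FreeMor.sound (.hexagon m n p)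

/-- The value of a term in a PROP, given values of the symbols. -/
def Term.eval {S : Signature.{u}} {P : PROP.{u}} (v : ∀ {m n : ℕ}, S m n → P.Mor m n) :
    ∀ {m n : ℕ}, Term S m n → P.Mor m n
  | _, _, .id n => P.id n
  | _, _, .braid m n => P.braid m n
  | _, _, .gen s => v s
  | _, _, .comp f g => P.comp (Term.eval v f) (Term.eval v g)
  | _, _, .tensor f g => P.tensor (Term.eval v f) (Term.eval v g)

theorem Term.eval_recast {S : Signature.{u}} {P : PROP.{u}}
    (v : ∀ {m n : ℕ}, S m n → P.Mor m n) {m m' n n' : ℕ} (hm : m = m') (hn : n = n')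
    (f : Term S m n) :
    Term.eval v (recast (Term S) hm hn f) = recast P.Mor hm hn (Term.eval v f) := by
  subst hm hn; rfl

theorem Term.Rel.eval_eq {S : Signature.{u}} {P : PROP.{u}}
    (v : ∀ {m n : ℕ}, S m n → P.Mor m n) {m n : ℕ} {f g : Term S m n} (h : Term.Rel S f g) :
    Term.eval v f = Term.eval v g := by
  induction h with
  | refl => rfl
  | symm _ ih => exact ih.symm
  | trans _ _ ih ih' => exact ih.trans ih'
  | comp_congr _ _ ih ih' => simp only [Term.eval, ih, ih']
  | tensor_congr _ _ ih ih' => simp only [Term.eval, ih, ih']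
  | id_comp f => exact P.id_comp _
  | comp_id f => exact P.comp_id _
  | comp_assoc f g h => exact P.comp_assoc _ _ _
  | tensor_id m n => exact P.tensor_id _ _
  | tensor_comp f g f' g' => exact P.tensor_comp _ _ _ _
  | tensor_assoc f g h => rw [Term.eval_recast]; exact P.tensor_assoc _ _ _
  | unit_tensor f => rw [Term.eval_recast]; exact P.unit_tensor _
  | tensor_unit f => rw [Term.eval_recast]; exact P.tensor_unit _
  | braid_natural f g => exact P.braid_natural _ _
  | braid_symm m n => exact P.braid_symm _ _
  | hexagon m n p =>
    simp only [Term.eval, Term.eval_recast]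
    exact P.hexagon m n p

namespace FreePROP

/-- The PROP morphism out of the free PROP determined by values of the symbols. -/
def lift {S : Signature.{u}} {P : PROP.{u}} (v : ∀ {m n : ℕ}, S m n → P.Mor m n) :
    FreePROP S ⟶ P :=
  show PROP.Hom (FreePROP S) P from
  { map := fun f => Quot.lift (fun t => Term.eval v t) (fun _ _ h => h.eval_eq v) f
    map_id := fun _ => rfl
    map_comp := fun f g => by
      induction f using FreeMor.ind with | h f =>
      induction g using FreeMor.ind with | h g => rfl
    map_tensor := fun f g => by
      induction f using FreeMor.ind with | h f =>
      induction g using FreeMor.ind with | h g => rfl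
    map_braid := fun _ _ => rfl }

/-- Freeness: for any PROP `P` and any values in `P` of the symbols, there is a unique PROP
morphism out of the free PROP with these values; it is `lift`. -/
theorem existsUnique_lift {S : Signature.{u}} {P : PROP.{u}}
    (v : ∀ {m n : ℕ}, S m n → P.Mor m n) :
    ∃! F : PROP.Hom (FreePROP S) P, ∀ {m n : ℕ} (s : S m n),
      F.map (FreeMor.mk (Term.gen s) : FreeMor S m n) = v s := by
  refine ⟨lift v, fun s => rfl, fun F hF => ?_⟩
  refine PROP.Hom.ext ?_
  funext m n f
  induction f using FreeMor.ind with | h f =>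
  change _ = Term.eval v f
  induction f with
  | id n => exact F.map_id n
  | braid m n => exact F.map_braid m n
  | gen s => exact hF s
  | comp f g ihf ihg =>
    rw [Term.eval, ← ihf, ← ihg]
    exact F.map_comp (FreeMor.mk f : FreeMor S _ _) (FreeMor.mk g : FreeMor S _ _)
  | tensor f g ihf ihg =>
    rw [Term.eval, ← ihf, ← ihg]
    exact F.map_tensor (FreeMor.mk f : FreeMor S _ _) (FreeMor.mk g : FreeMor S _ _)

end FreePROP

/-- A set of equations over a signature: a set of ordered pairs of terms of the same type. -/
abbrev Equations (S : Signature.{u}) : Type u :=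
  ∀ m n : ℕ, Set (Term S m n × Term S m n)

namespace Equations

variable {S : Signature.{u}}

/-- The signature with one formal symbol for each equation, of the type of that equation. -/
def signature (E : Equations S) : Signature.{u} := fun m n => ↥(E m n)

/-- The PROP morphism sending each equation to its left-hand side. -/
def lhs (E : Equations S) : FreePROP E.signature ⟶ FreePROP S :=
  FreePROP.lift fun {m n} (e : ↥(E m n)) => (FreeMor.mk e.1.1 : FreeMor S m n)

/-- The PROP morphism sending each equation to its right-hand side. -/
def rhs (E : Equations S) : FreePROP E.signature ⟶ FreePROP S :=
  FreePROP.lift fun {m n} (e : ↥(E m n)) => (FreeMor.mk e.1.2 : FreeMor S m n)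

end Equations

/-- The PROP `P`, with the values `v` of the symbols of `S`, is presented by the symmetric monoidal
theory `(S, E)`: the PROP morphism `FreePROP S ⟶ P` determined by `v` is a coequalizer, in the
category of PROPs, of the two morphisms `FreePROP E.signature ⇉ FreePROP S`. -/
def IsPresentedBy (P : PROP.{u}) (S : Signature.{u}) (E : Equations S)
    (v : ∀ {m n : ℕ}, S m n → P.Mor m n) : Prop :=
  ∃ w : E.lhs ≫ FreePROP.lift v = E.rhs ≫ FreePROP.lift v,
    Nonempty (IsColimit (Cofork.ofπ (FreePROP.lift v) w))

section FinVect

variable (k : Type u) [Field k]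

/-- Linear maps `kᵐ → kⁿ`. -/
abbrev FinVectMor (m n : ℕ) : Type u := (Fin m → k) →ₗ[k] (Fin n → k)

/-- The first `m` coordinates of a vector of `kᵐ⁺ⁿ = kᵐ ⊕ kⁿ`. -/
abbrev fstPart {k : Type u} {m n : ℕ} (x : Fin (m + n) → k) : Fin m → k :=
  fun i => x (Fin.castAdd n i)

/-- The last `n` coordinates of a vector of `kᵐ⁺ⁿ = kᵐ ⊕ kⁿ`. -/
abbrev sndPart {k : Type u} {m n : ℕ} (x : Fin (m + n) → k) : Fin n → k :=
  fun i => x (Fin.natAdd m i)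

/-- The direct sum of linear maps, `(x, y) ↦ (f x, g y)`, with `kᵐ ⊕ kᵖ = kᵐ⁺ᵖ`. -/
def FinVectMor.tensor {m n p q : ℕ} (f : FinVectMor k m n) (g : FinVectMor k p q) :
    FinVectMor k (m + p) (n + q) where
  toFun x := Fin.append (f (fstPart x)) (g (sndPart x))
  map_add' x y := by
    have h1 : fstPart (x + y) = fstPart x + fstPart y := rfl
    have h2 : sndPart (x + y) = sndPart x + sndPart y := rfl
    rw [h1, h2, map_add, map_add]
    funext i
    refine Fin.addCases (fun i => ?_) (fun i => ?_) i <;> simp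
  map_smul' c x := by
    have h1 : fstPart (c • x) = c • fstPart x := rfl
    have h2 : sndPart (c • x) = c • sndPart x := rfl
    rw [h1, h2, map_smul, map_smul]
    funext i
    refine Fin.addCases (fun i => ?_) (fun i => ?_) i <;> simp

/-- The braiding `kᵐ ⊕ kⁿ → kⁿ ⊕ kᵐ`, `(x, y) ↦ (y, x)`. -/
def FinVectMor.braid (m n : ℕ) : FinVectMor k (m + n) (n + m) where
  toFun x := Fin.append (sndPart x) (fstPart x)
  map_add' x y := by
    funext i
    refine Fin.addCases (fun i => ?_) (fun i => ?_) i <;> simp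
  map_smul' c x := by
    funext i
    refine Fin.addCases (fun i => ?_) (fun i => ?_) i <;> simp

theorem FinVectMor.recast_apply {m m' n n' : ℕ} (hm : m = m') (hn : n = n')
    (f : FinVectMor k m n) (x : Fin m' → k) (i : Fin n') :
    (recast (FinVectMor k) hm hn f) x i = f (fun j => x (Fin.cast hm j)) (Fin.cast hn.symm i) := by
  subst hm hn; rfl

theorem fstPart_append {k : Type u} {m n : ℕ} (x : Fin m → k) (y : Fin n → k) :
    fstPart (Fin.append x y) = x := funext fun i => Fin.append_left x y i

theorem sndPart_append {k : Type u} {m n : ℕ} (x : Fin m → k) (y : Fin n → k) :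
    sndPart (Fin.append x y) = y := funext fun i => Fin.append_right x y i

theorem FinVectMor.tensor_apply {m n p q : ℕ} (f : FinVectMor k m n) (g : FinVectMor k p q)
    (x : Fin (m + p) → k) :
    FinVectMor.tensor k f g x = Fin.append (f (fstPart x)) (g (sndPart x)) := rfl

theorem FinVectMor.braid_apply (m n : ℕ) (x : Fin (m + n) → k) :
    FinVectMor.braid k m n x = Fin.append (sndPart x) (fstPart x) := rfl

/-- The PROP of linear maps `kᵐ → kⁿ`, with composition of linear maps as composition and direct
sum as monoidal product. -/
def FinVect : PROP.{u} where
  Mor := FinVectMor k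
  id n := LinearMap.id
  comp f g := g.comp f
  tensor := FinVectMor.tensor k
  braid := FinVectMor.braid k
  id_comp f := rfl
  comp_id f := rfl
  comp_assoc f g h := rfl
  tensor_id m n := by
    refine LinearMap.ext fun x => ?_
    exact Fin.append_castAdd_natAdd
  tensor_comp f g f' g' := by
    refine LinearMap.ext fun x => ?_
    simp only [FinVectMor.tensor_apply, LinearMap.comp_apply, fstPart_append, sndPart_append]
  tensor_assoc {m n p q r s} f g h := by
    refine LinearMap.ext fun x => funext fun i => ?_
    rw [FinVectMor.recast_apply]
    simp only [FinVectMor.tensor_apply]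
    have hx : sndPart (fun j => x (Fin.cast (Nat.add_assoc m p r) j)) = sndPart (sndPart x) :=
      funext fun j => congrArg x (Fin.ext (Nat.add_assoc m p j))
    rw [Fin.append_assoc, hx]
    rfl
  unit_tensor {m n} f := by
    refine LinearMap.ext fun x => funext fun i => ?_
    rw [FinVectMor.recast_apply, FinVectMor.tensor_apply]
    have hx : sndPart (fun j => x (Fin.cast (Nat.zero_add m) j)) = x :=
      funext fun j => congrArg x (Fin.ext (Nat.zero_add j))
    have hi : Fin.cast (Nat.zero_add n).symm i = Fin.natAdd 0 i :=
      Fin.ext (Nat.zero_add i).symm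
    rw [hi, Fin.append_right, hx]
  tensor_unit {m n} f := by
    refine LinearMap.ext fun x => funext fun i => ?_
    rw [FinVectMor.recast_apply, FinVectMor.tensor_apply]
    exact Fin.append_left _ _ i
  braid_natural f g := by
    refine LinearMap.ext fun x => ?_
    simp only [FinVectMor.tensor_apply, FinVectMor.braid_apply, LinearMap.comp_apply,
      fstPart_append, sndPart_append]
  braid_symm m n := by
    refine LinearMap.ext fun x => ?_
    simp only [FinVectMor.braid_apply, LinearMap.comp_apply, fstPart_append, sndPart_append]
    exact Fin.append_castAdd_natAdd
  hexagon m n p := by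
    refine LinearMap.ext fun x => funext fun i => ?_
    have h2 : recast (FinVectMor k) rfl (Nat.add_assoc n m p)
          (FinVectMor.tensor k (FinVectMor.braid k m n) LinearMap.id) x =
        Fin.append (sndPart (fstPart x)) (Fin.append (fstPart (fstPart x)) (sndPart x)) := by
      funext j
      rw [FinVectMor.recast_apply, FinVectMor.tensor_apply, FinVectMor.braid_apply,
        Fin.append_assoc]
      rfl
    have hx : sndPart (fun j => x (Fin.cast (Nat.add_assoc m n p).symm j)) =
        Fin.append (sndPart (fstPart x)) (sndPart x) := by
      funext j
      refine Fin.addCases (fun j => ?_) (fun j => ?_) j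
      · rw [Fin.append_left]; rfl
      · rw [Fin.append_right]
        exact congrArg x (Fin.ext (Nat.add_assoc m n j).symm)
    rw [LinearMap.comp_apply, h2, FinVectMor.recast_apply, FinVectMor.tensor_apply,
      FinVectMor.braid_apply, FinVectMor.braid_apply]
    simp only [fstPart_append, sndPart_append, LinearMap.id_apply]
    rw [hx, Fin.append_assoc]
    rfl

/-- The formal generators: scaling by each `c : k`, addition, zero, duplication, deletion. -/
inductive FinVectGen : ℕ → ℕ → Type u
  | scale (c : k) : FinVectGen 1 1
  | add : FinVectGen 2 1
  | zero : FinVectGen 0 1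
  | dup : FinVectGen 1 2
  | del : FinVectGen 1 0

/-- The linear maps named by the generators: scaling `x ↦ c x`, addition `(x, y) ↦ x + y`, zero
`k⁰ → k`, duplication `x ↦ (x, x)` and deletion `k → k⁰`. -/
def FinVectGen.toLinearMap : ∀ {m n : ℕ}, FinVectGen k m n → (FinVect k).Mor m n
  | _, _, .scale c =>
    show FinVectMor k 1 1 from
    { toFun := fun x _ => c * x 0
      map_add' := fun x y => funext fun _ => mul_add c (x 0) (y 0)
      map_smul' := fun a x => funext fun _ => mul_left_comm c a (x 0) }
  | _, _, .add =>
    show FinVectMor k 2 1 from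
    { toFun := fun x _ => x 0 + x 1
      map_add' := fun x y => funext fun _ => add_add_add_comm (x 0) (y 0) (x 1) (y 1)
      map_smul' := fun a x => funext fun _ => (mul_add a (x 0) (x 1)).symm }
  | _, _, .zero =>
    show FinVectMor k 0 1 from
    { toFun := fun _ _ => 0
      map_add' := fun _ _ => funext fun _ => (add_zero 0).symm
      map_smul' := fun a _ => funext fun _ => (mul_zero a).symm }
  | _, _, .dup =>
    show FinVectMor k 1 2 from
    { toFun := fun x _ => x 0
      map_add' := fun _ _ => rfl
      map_smul' := fun _ _ => rfl }
  | _, _, .del =>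
    show FinVectMor k 1 0 from
    { toFun := fun _ => Fin.elim0
      map_add' := fun _ _ => Subsingleton.elim _ _
      map_smul' := fun _ _ => Subsingleton.elim _ _ }

namespace FinVectTerm

/-- The generator "scaling by `c`", as a term. -/
abbrev scale {k : Type u} (c : k) : Term (FinVectGen k) 1 1 := .gen (.scale c)

/-- The generator "addition", as a term. -/
abbrev add : Term (FinVectGen k) 2 1 := .gen .add

/-- The generator "zero", as a term. -/
abbrev zero : Term (FinVectGen k) 0 1 := .gen .zero

/-- The generator "duplication", as a term. -/
abbrev dup : Term (FinVectGen k) 1 2 := .gen .dup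

/-- The generator "deletion", as a term. -/
abbrev del : Term (FinVectGen k) 1 0 := .gen .del

/-- The identity of the object `1`, as a term. -/
abbrev one : Term (FinVectGen k) 1 1 := .id 1

/-- The braiding of the object `1` with itself, as a term. -/
abbrev swap : Term (FinVectGen k) 2 2 := .braid 1 1

end FinVectTerm

open FinVectTerm in
/-- The equations between the generators; `comp f g` is "first `f`, then `g`". -/
inductive FinVectEq : ∀ m n : ℕ, Term (FinVectGen k) m n → Term (FinVectGen k) m n → Prop
  -- Addition and zero form a commutative monoid.
  | add_unit : FinVectEq 1 1 (((zero k).tensor (one k)).comp (add k)) (one k)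
  | add_assoc : FinVectEq 3 1 (((one k).tensor (add k)).comp (add k))
      (((add k).tensor (one k)).comp (add k))
  | add_comm : FinVectEq 2 1 ((swap k).comp (add k)) (add k)
  -- Duplication and deletion form a cocommutative comonoid.
  | dup_counit : FinVectEq 1 1 ((dup k).comp ((del k).tensor (one k))) (one k)
  | dup_coassoc : FinVectEq 1 3 ((dup k).comp ((one k).tensor (dup k)))
      ((dup k).comp ((dup k).tensor (one k)))
  | dup_cocomm : FinVectEq 1 2 ((dup k).comp (swap k)) (dup k)
  -- The monoid and the comonoid form a bimonoid.
  | add_dup : FinVectEq 2 2 ((add k).comp (dup k))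
      (((dup k).tensor (dup k)).comp
        ((((one k).tensor (swap k)).tensor (one k)).comp ((add k).tensor (add k))))
  | zero_dup : FinVectEq 0 2 ((zero k).comp (dup k)) ((zero k).tensor (zero k))
  | add_del : FinVectEq 2 0 ((add k).comp (del k)) ((del k).tensor (del k))
  | zero_del : FinVectEq 0 0 ((zero k).comp (del k)) (Term.id 0)
  -- The rig operations of the field are recovered from the generators.
  | scale_mul (b c : k) : FinVectEq 1 1 (scale (b * c)) ((scale c).comp (scale b))
  | scale_add (b c : k) : FinVectEq 1 1 (scale (b + c))
      ((dup k).comp (((scale b).tensor (scale c)).comp (add k)))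
  | scale_one : FinVectEq 1 1 (scale 1) (one k)
  | scale_zero : FinVectEq 1 1 (scale 0) ((del k).comp (zero k))
  -- Scaling commutes with addition and zero.
  | add_scale (c : k) : FinVectEq 2 1 (((scale c).tensor (scale c)).comp (add k))
      ((add k).comp (scale c))
  | zero_scale (c : k) : FinVectEq 0 1 ((zero k).comp (scale c)) (zero k)
  -- Scaling commutes with duplication and deletion.
  | dup_scale (c : k) : FinVectEq 1 2 ((dup k).comp ((scale c).tensor (scale c)))
      ((scale c).comp (dup k))
  | del_scale (c : k) : FinVectEq 1 0 ((scale c).comp (del k)) (del k)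

/-- The set of all these equations. -/
def finVectEquations : Equations (FinVectGen k) :=
  fun m n => {e | FinVectEq k m n e.1 e.2}

end FinVect

/-! A cofork under the two equation morphisms is the same thing as an interpretation of the
generators in a PROP `P` satisfying the equations (a `Model`). So two facts suffice: every linear
map is denoted by a term (`exists_toLinearMap_eq`), and in any model the value of a term depends
only on the linear map it denotes (`eval_eq_of_toLinearMap_eq`).

No normal form of terms is needed for the second fact. In a model the object `1` is a commutative
monoid and `n` carries the tensor power structure. The bimonoid equations and the compatibility of
scaling with addition and zero say that every generator is a monoid morphism, hence so is the value
of every term (`preserves_eval`). A monoid morphism out of a tensor product is determined by its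
restrictions to the two factors, so by induction on the source a value is determined by its columns
`1 ⟶ n` (`eval_succ`). The remaining equations say that composing a column vector with a term
applies the denoted linear map to it (`col_eval`); applied to the vector `1`, this recovers each
column from the linear map. -/

open MonoidalCategory

/-! ### PROPs as symmetric monoidal categories -/

namespace PROP

/-- The objects of a PROP, as the carrier of a symmetric monoidal category. -/
def Obj (_ : PROP.{u}) : Type := ℕ

/-- The object `n` of a PROP. -/
abbrev obj (P : PROP.{u}) (n : ℕ) : P.Obj := n

variable {P : PROP.{u}}

instance : Category.{u} P.Obj where
  Hom m n := P.Mor m n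
  id n := P.id n
  comp f g := P.comp f g
  id_comp f := P.id_comp f
  comp_id f := P.comp_id f
  assoc f g h := P.comp_assoc f g h

theorem recast_eq {m m' n n' : P.Obj} (hm : m = m') (hn : n = n') (f : m ⟶ n) :
    recast P.Mor hm hn f = eqToHom hm.symm ≫ f ≫ eqToHom hn := by
  subst hm hn
  simp only [eqToHom_refl, Category.id_comp, Category.comp_id]
  rfl

/-- Since addition recurses on its right argument, the associator at `m`, `n`, `1`, the right
unitor, and the left unitor at `1` are identities by definition. Later proofs rely on this. -/
instance : MonoidalCategoryStruct P.Obj where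
  tensorObj m n := Nat.add m n
  tensorUnit := Nat.zero
  tensorHom f g := P.tensor f g
  whiskerLeft m _ _ f := P.tensor (P.id m) f
  whiskerRight f n := P.tensor f (P.id n)
  associator m n p := eqToIso (Nat.add_assoc m n p)
  leftUnitor m := eqToIso (Nat.zero_add m)
  rightUnitor m := eqToIso (Nat.add_zero m)

theorem tensorObj_assoc (m n p : P.Obj) : (m ⊗ n) ⊗ p = m ⊗ n ⊗ p := Nat.add_assoc m n p

theorem unit_tensorObj (m : P.Obj) : 𝟙_ P.Obj ⊗ m = m := Nat.zero_add m

theorem tensorObj_unit (m : P.Obj) : m ⊗ 𝟙_ P.Obj = m := Nat.add_zero m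

theorem associator_hom (m n p : P.Obj) : (α_ m n p).hom = eqToHom (tensorObj_assoc m n p) := rfl

theorem leftUnitor_hom (m : P.Obj) : (λ_ m).hom = eqToHom (unit_tensorObj m) := rfl

theorem rightUnitor_hom (m : P.Obj) : (ρ_ m).hom = eqToHom (tensorObj_unit m) := rfl

theorem eqToHom_tensor_id {m n : P.Obj} (h : m = n) (p : P.Obj) :
    eqToHom h ⊗ₘ 𝟙 p = eqToHom (congrArg (· ⊗ p) h) := by
  subst h
  exact P.tensor_id _ _

theorem id_tensor_eqToHom {m n : P.Obj} (h : m = n) (p : P.Obj) :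
    𝟙 p ⊗ₘ eqToHom h = eqToHom (congrArg (p ⊗ ·) h) := by
  subst h
  exact P.tensor_id _ _

/-- Turns the strict associativity and unit laws of a PROP into naturality squares for the
structural isomorphisms. -/
theorem comp_eqToHom_eq_of_recast {m m' n n' : P.Obj} {hm : m = m'} {hn : n = n'} {f : m ⟶ n}
    {g : m' ⟶ n'} (h : recast P.Mor hm hn f = g) : f ≫ eqToHom hn = eqToHom hm ≫ g := by
  subst hm hn h
  simp only [eqToHom_refl, Category.id_comp, Category.comp_id]
  rfl

instance : MonoidalCategory P.Obj :=
  MonoidalCategory.ofTensorHom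
    (id_tensorHom_id := fun m n => P.tensor_id m n)
    (id_tensorHom := fun _ _ _ _ => rfl)
    (tensorHom_id := fun _ _ => rfl)
    (tensorHom_comp_tensorHom := fun f₁ f₂ g₁ g₂ => (P.tensor_comp f₁ g₁ f₂ g₂).symm)
    (associator_naturality := fun f g h => comp_eqToHom_eq_of_recast (P.tensor_assoc f g h))
    (leftUnitor_naturality := fun f => comp_eqToHom_eq_of_recast (P.unit_tensor f))
    (rightUnitor_naturality := fun f => comp_eqToHom_eq_of_recast (P.tensor_unit f))
    (pentagon := fun m n p q => by
      simp only [associator_hom, eqToHom_tensor_id, id_tensor_eqToHom, eqToHom_trans])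
    (triangle := fun m n => by
      simp only [associator_hom, leftUnitor_hom, rightUnitor_hom, eqToHom_tensor_id,
        id_tensor_eqToHom, eqToHom_trans])

/-- The braiding of a PROP as an isomorphism. -/
def braidIso (m n : P.Obj) : m ⊗ n ≅ n ⊗ m where
  hom := P.braid m n
  inv := P.braid n m
  hom_inv_id := P.braid_symm m n
  inv_hom_id := P.braid_symm n m

theorem braidIso_hexagon (m n p : P.Obj) :
    (α_ m n p).hom ≫ (braidIso m (n ⊗ p)).hom ≫ (α_ n p m).hom =
      ((braidIso m n).hom ▷ p) ≫ (α_ n m p).hom ≫ (n ◁ (braidIso m p).hom) := by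
  have h := P.hexagon m n p
  have h1 := recast_eq (tensorObj_assoc m n p).symm (tensorObj_assoc n p m) (braidIso m (n ⊗ p)).hom
  have h2 := recast_eq rfl (tensorObj_assoc n m p) ((braidIso m n).hom ▷ p)
  rw [eqToHom_refl, Category.id_comp] at h2
  refine (h1.symm.trans h).trans ((congrArg (fun f => P.comp f _) h2).trans ?_)
  exact P.comp_assoc _ _ _

instance : SymmetricCategory P.Obj where
  braiding := braidIso
  braiding_naturality_right m _ _ f := P.braid_natural (P.id m) f
  braiding_naturality_left f p := P.braid_natural f (P.id p)
  hexagon_forward := braidIso_hexagon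
  hexagon_reverse m n p := by
    -- The reverse hexagon at `m`, `n`, `p` is the inverse of the forward one at `p`, `m`, `n`,
    -- because inverting a braiding swaps its arguments.
    have h := congrArg Iso.inv (Iso.ext (α := (α_ p m n) ≪≫ braidIso p (m ⊗ n) ≪≫ α_ m n p)
      (β := whiskerRightIso (braidIso p m) n ≪≫ α_ m p n ≪≫ whiskerLeftIso m (braidIso p n))
      (braidIso_hexagon p m n))
    simp only [Iso.trans_inv, Category.assoc, whiskerRightIso_inv, whiskerLeftIso_inv] at h
    exact h
  symmetry m n := P.braid_symm m n

end PROP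

/-! ### Maps out of tensor products of monoids; coassociativity -/

section MonoidObjects

universe w z

variable {C : Type w} [Category.{z} C] [MonoidalCategory C]

open scoped MonObj ComonObj

namespace CategoryTheory.MonObj

/-- A morphism out of a tensor product of monoid objects which preserves multiplication is
determined by its restrictions to the two factors. -/
theorem eq_restrict_tensor_restrict_mul [BraidedCategory C] {X Y Z : C} [MonObj X] [MonObj Y]
    [MonObj Z] (f : X ⊗ Y ⟶ Z) (hf : (tensorμ X Y X Y ≫ (μ[X] ⊗ₘ μ[Y])) ≫ f = (f ⊗ₘ f) ≫ μ[Z]) :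
    f = (((ρ_ X).inv ≫ X ◁ η[Y] ≫ f) ⊗ₘ ((λ_ Y).inv ≫ η[X] ▷ Y ≫ f)) ≫ μ[Z] := by
  rw [← Category.assoc, ← Category.assoc (λ_ Y).inv, ← tensorHom_comp_tensorHom, Category.assoc,
    ← hf, ← tensorHom_comp_tensorHom, ← id_tensorHom, ← tensorHom_id]
  simp only [Category.assoc]
  rw [tensorμ_natural_assoc, tensorHom_comp_tensorHom_assoc, id_tensorHom, tensorHom_id,
    MonObj.one_mul, MonObj.mul_one]
  -- After the unit laws only an exchange of two copies of the unit object remains, which is trivial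
  -- by coherence.
  have h : ((ρ_ X).inv ⊗ₘ (λ_ Y).inv) ≫ tensorμ X (𝟙_ C) (𝟙_ C) Y ≫
      ((ρ_ X).hom ⊗ₘ (λ_ Y).hom) = 𝟙 (X ⊗ Y) := by
    simp only [tensorμ, braiding_tensorUnit_left]
    monoidal
  rw [reassoc_of% h]

end CategoryTheory.MonObj

namespace CategoryTheory.ComonObj

theorem comul_tensor_comul_assoc {W X Y Z : C} [ComonObj W] (f : W ⟶ X) (g : W ⟶ Y) (h : W ⟶ Z) :
    Δ[W] ≫ ((Δ[W] ≫ (f ⊗ₘ g)) ⊗ₘ h) ≫ (α_ X Y Z).hom =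
      Δ[W] ≫ (f ⊗ₘ (Δ[W] ≫ (g ⊗ₘ h))) := by
  have h1 : (Δ[W] ≫ (f ⊗ₘ g)) ⊗ₘ h = (Δ[W] ▷ W) ≫ ((f ⊗ₘ g) ⊗ₘ h) := by
    rw [← tensorHom_id, tensorHom_comp_tensorHom, Category.id_comp]
  have h2 : f ⊗ₘ (Δ[W] ≫ (g ⊗ₘ h)) = (W ◁ Δ[W]) ≫ (f ⊗ₘ (g ⊗ₘ h)) := by
    rw [← id_tensorHom, tensorHom_comp_tensorHom, Category.id_comp]
  rw [h1, h2, Category.assoc, associator_naturality, ComonObj.comul_assoc_assoc]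

end CategoryTheory.ComonObj

end MonoidObjects

/-! ### Models of the theory; the object `1` as monoid and comonoid -/

namespace FinVectGen

variable {k : Type u} [Field k] {P : PROP.{u}}

open scoped MonObj ComonObj

/-- An interpretation of the generators in a PROP which satisfies all the equations. -/
structure Model (k : Type u) [Field k] (P : PROP.{u}) where
  /-- The values of the generators. -/
  val : ∀ {m n : ℕ}, FinVectGen k m n → P.Mor m n
  eval_eq : ∀ {m n : ℕ} {f g : Term (FinVectGen k) m n}, FinVectEq k m n f g →
    Term.eval val f = Term.eval val g

namespace Model

variable (M : Model k P)

/-- The value of a term. -/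
def eval {m n : ℕ} (t : Term (FinVectGen k) m n) : P.obj m ⟶ P.obj n := Term.eval M.val t

theorem eval_comp {m n p : ℕ} (f : Term (FinVectGen k) m n) (g : Term (FinVectGen k) n p) :
    M.eval (f.comp g) = M.eval f ≫ M.eval g := rfl

theorem eval_tensor {m n p q : ℕ} (f : Term (FinVectGen k) m n) (g : Term (FinVectGen k) p q) :
    M.eval (f.tensor g) = M.eval f ⊗ₘ M.eval g := rfl

/-- The value of scaling. -/
def scale (c : k) : P.obj 1 ⟶ P.obj 1 := M.val (.scale c)
/-- The value of addition. -/
def add : P.obj 1 ⊗ P.obj 1 ⟶ P.obj 1 := M.val .add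
/-- The value of zero. -/
def zero : 𝟙_ P.Obj ⟶ P.obj 1 := M.val .zero
/-- The value of duplication. -/
def dup : P.obj 1 ⟶ P.obj 1 ⊗ P.obj 1 := M.val .dup
/-- The value of deletion. -/
def del : P.obj 1 ⟶ 𝟙_ P.Obj := M.val .del

theorem add_comm : (β_ (P.obj 1) (P.obj 1)).hom ≫ M.add = M.add := M.eval_eq .add_comm

theorem dup_comm : M.dup ≫ (β_ (P.obj 1) (P.obj 1)).hom = M.dup := M.eval_eq .dup_cocomm

/-- The monoid structure on the object `1` given by addition and zero. -/
abbrev monObjOne : MonObj (P.obj 1) where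
  one := M.zero
  mul := M.add
  one_mul := M.eval_eq .add_unit
  mul_one := by
    -- The equations contain only the left unit law; the right one follows by commutativity.
    have h : P.obj 1 ◁ M.zero ≫ M.add =
        (β_ _ _).hom ≫ (M.zero ▷ P.obj 1) ≫ M.add := by
      rw [← BraidedCategory.braiding_naturality_right_assoc, add_comm]
    rw [h, show (M.zero ▷ P.obj 1) ≫ M.add = (λ_ _).hom from M.eval_eq .add_unit,
      braiding_leftUnitor]
  mul_assoc := by
    refine (M.eval_eq .add_assoc).symm.trans ?_
    exact (P.id_comp _).symm

/-- The comonoid structure on the object `1` given by duplication and deletion. -/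
abbrev comonObjOne : ComonObj (P.obj 1) where
  counit := M.del
  comul := M.dup
  counit_comul := M.eval_eq .dup_counit
  comul_counit := by
    -- Dually, cocommutativity supplies the missing right counit law.
    have h : M.dup ≫ P.obj 1 ◁ M.del = (M.dup ≫ (M.del ▷ P.obj 1)) ≫ (β_ _ _).hom := by
      rw [Category.assoc, BraidedCategory.braiding_naturality_left, ← Category.assoc, dup_comm]
    rw [h, show M.dup ≫ (M.del ▷ P.obj 1) = (λ_ _).inv from M.eval_eq .dup_counit]
    rw [Iso.inv_comp_eq, braiding_tensorUnit_left]
  comul_assoc := by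
    refine (M.eval_eq .dup_coassoc).trans ?_
    exact congrArg (M.dup ≫ ·) (P.comp_id _).symm

end Model
end FinVectGen

/-! ### Monoid morphisms with explicit monoid structures -/

section MonoidObjects

universe w z

variable {C : Type w} [Category.{z} C] [MonoidalCategory C]

open scoped MonObj ComonObj

namespace CategoryTheory.MonObj

/-- A morphism preserves given monoid structures on its source and target. -/
def Preserves {X Y : C} (a : MonObj X) (b : MonObj Y) (f : X ⟶ Y) : Prop := IsMonHom f

/-- The monoid structure on a tensor product. -/
abbrev tensor [BraidedCategory C] {X Y : C} (a : MonObj X) (b : MonObj Y) : MonObj (X ⊗ Y) :=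
  inferInstance

namespace Preserves

theorem mk {X Y : C} {a : MonObj X} {b : MonObj Y} {f : X ⟶ Y} (h_one : a.one ≫ f = b.one)
    (h_mul : a.mul ≫ f = (f ⊗ₘ f) ≫ b.mul) : Preserves a b f :=
  @IsMonHom.mk _ _ _ _ _ a b f h_one h_mul

/-- In a PROP one object is a tensor product in several ways and so receives several monoid
structures. Where a coherence isomorphism is an identity by definition, its being a monoid morphism
identifies two of them. -/
theorem eq_of_id {X : C} {a b : MonObj X} (h : Preserves a b (𝟙 X)) : a = b := by
  refine MonObj.ext _ _ ?_
  have := h.mul_hom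
  simpa using this

theorem id {X : C} (a : MonObj X) : Preserves a a (𝟙 X) :=
  inferInstanceAs (IsMonHom (𝟙 X))

theorem comp {X Y Z : C} {a : MonObj X} {b : MonObj Y} {c : MonObj Z} {f : X ⟶ Y} {g : Y ⟶ Z}
    (hf : Preserves a b f) (hg : Preserves b c g) : Preserves a c (f ≫ g) :=
  have : IsMonHom f := hf
  have : IsMonHom g := hg
  inferInstanceAs (IsMonHom (f ≫ g))

theorem one {X : C} (a : MonObj X) : Preserves inferInstance a η[X] := by
  refine .mk ?_ ?_
  · exact Category.id_comp _
  · exact (MonObj.one_mul_hom _).symm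

variable [BraidedCategory C]

theorem tensorHom {X Y Z W : C} {a : MonObj X} {b : MonObj Y} {c : MonObj Z} {d : MonObj W}
    {f : X ⟶ Y} {g : Z ⟶ W} (hf : Preserves a b f) (hg : Preserves c d g) :
    Preserves (a.tensor c) (b.tensor d) (f ⊗ₘ g) :=
  have : IsMonHom f := hf
  have : IsMonHom g := hg
  inferInstanceAs (IsMonHom (f ⊗ₘ g))

theorem associator_hom {X Y Z : C} (a : MonObj X) (b : MonObj Y) (c : MonObj Z) :
    Preserves ((a.tensor b).tensor c) (a.tensor (b.tensor c)) (α_ X Y Z).hom :=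
  inferInstanceAs (IsMonHom (α_ X Y Z).hom)

theorem leftUnitor_hom {X : C} (a : MonObj X) :
    Preserves (MonObj.tensor inferInstance a) a (λ_ X).hom :=
  inferInstanceAs (IsMonHom (λ_ X).hom)

theorem rightUnitor_hom {X : C} (a : MonObj X) :
    Preserves (a.tensor inferInstance) a (ρ_ X).hom :=
  inferInstanceAs (IsMonHom (ρ_ X).hom)

/-- The multiplication of a commutative monoid object preserves the monoid structures. -/
theorem mul {X : C} {a : MonObj X} (h : (β_ X X).hom ≫ μ[X] = μ[X]) :
    Preserves (a.tensor a) a μ[X] := by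
  have : IsCommMonObj X := ⟨h⟩
  refine .mk ?_ ?_
  · have : (λ_ (𝟙_ C)).inv ≫ (η[X] ⊗ₘ η[X]) ≫ μ[X] = η[X] := by
      rw [MonObj.one_mul_hom, Iso.inv_hom_id_assoc]
    exact (Category.assoc _ _ _).trans this
  · exact (Category.assoc _ _ _).trans (MonObj.mul_mul_mul_comm X)

end Preserves

theorem Preserves.braiding_hom [SymmetricCategory C] {X Y : C} (a : MonObj X) (b : MonObj Y) :
    Preserves (a.tensor b) (b.tensor a) (β_ X Y).hom :=
  inferInstanceAs (IsMonHom (β_ X Y).hom)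

end CategoryTheory.MonObj

end MonoidObjects

/-! ### Values of terms are monoid morphisms -/

namespace FinVectGen.Model

variable {k : Type u} [Field k] {P : PROP.{u}} (M : Model k P)

open scoped MonObj ComonObj

/-- The monoid structure on the object `n` as a tensor power of the one on the object `1`. -/
@[reducible] def monObj : ∀ n : ℕ, MonObj (P.obj n)
  | 0 => (inferInstance : MonObj (𝟙_ P.Obj))
  | n + 1 => MonObj.tensor (monObj n) M.monObjOne

theorem monObj_one : M.monObj 1 = M.monObjOne :=
  MonObj.Preserves.eq_of_id (MonObj.Preserves.leftUnitor_hom M.monObjOne)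

theorem monObj_add (m : ℕ) : ∀ n : ℕ, M.monObj (m + n) = (M.monObj m).tensor (M.monObj n)
  | 0 => (MonObj.Preserves.eq_of_id (MonObj.Preserves.rightUnitor_hom (M.monObj m))).symm
  | n + 1 => by
    have h := MonObj.Preserves.eq_of_id (X := P.obj (m + n + 1))
      (MonObj.Preserves.associator_hom (M.monObj m) (M.monObj n) M.monObjOne)
    rw [← monObj_add m n] at h
    exact h

/-- All associators involved are identities. This matches the middle exchange in the bimonoid
equation with the one in the multiplication of a tensor product of monoids. -/
theorem tensorμ_obj_one : tensorμ (P.obj 1) (P.obj 1) (P.obj 1) (P.obj 1) =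
    P.tensor (P.tensor (P.id 1) (P.braid 1 1)) (P.id 1) := by
  have h : P.tensor (P.tensor (P.id 1) (P.braid 1 1)) (P.id 1) =
    P.tensor (P.id 1) (P.tensor (P.braid 1 1) (P.id 1)) :=
    P.tensor_assoc (P.id 1) (P.braid 1 1) (P.id 1)
  rw [h]
  change P.comp (P.id 4) (P.comp (P.tensor (P.id 1) (P.id 3)) (P.comp (P.tensor (P.id 1)
    (P.tensor (P.braid 1 1) (P.id 1))) (P.comp (P.tensor (P.id 1) (P.id 3)) (P.id 4)))) = _
  rw [P.tensor_id]
  simp only [P.id_comp, P.comp_id]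

theorem preserves_scale (c : k) : (M.monObjOne).Preserves M.monObjOne (M.scale c) :=
  .mk (M.eval_eq (.zero_scale c)) (M.eval_eq (.add_scale c)).symm

theorem preserves_dup : (M.monObjOne).Preserves (M.monObjOne.tensor M.monObjOne) M.dup := by
  refine .mk ((M.eval_eq .zero_dup).trans (P.id_comp _).symm) ((M.eval_eq .add_dup).trans ?_)
  change _ = (M.dup ⊗ₘ M.dup) ≫ tensorμ (P.obj 1) (P.obj 1) (P.obj 1) (P.obj 1) ≫ _
  rw [tensorμ_obj_one]
  rfl

theorem preserves_del : (M.monObjOne).Preserves inferInstance M.del := by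
  refine .mk (M.eval_eq .zero_del) ((M.eval_eq .add_del).trans (P.comp_id _).symm)

/-- Monoid morphisms are closed under composition and tensor, and include identities and, by
symmetry, braidings, so only generators matter. Addition qualifies because it is commutative, zero
because it is the unit; the other generators need one equation for the unit and one for the product.
-/
theorem preserves_eval {m n : ℕ} (t : Term (FinVectGen k) m n) :
    (M.monObj m).Preserves (M.monObj n) (M.eval t) := by
  induction t with
  | id n => exact .id _
  | braid m n =>
    rw [monObj_add, monObj_add]
    exact .braiding_hom _ _
  | gen s =>
    have h2 : M.monObj 2 = M.monObjOne.tensor M.monObjOne := by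
      rw [monObj_add M 1 1, monObj_one]
    cases s with
    | scale c => rw [monObj_one]; exact M.preserves_scale c
    | add =>
      rw [h2, monObj_one]
      exact .mul (a := M.monObjOne) M.add_comm
    | zero => rw [monObj_one]; exact .one M.monObjOne
    | dup => rw [h2, monObj_one]; exact M.preserves_dup
    | del => rw [monObj_one]; exact M.preserves_del
  | comp f g hf hg => exact .comp hf hg
  | tensor f g hf hg =>
    rw [monObj_add, monObj_add]
    exact .tensorHom hf hg

end FinVectGen.Model

/-! ### Column vectors, and dependence on the linear map alone -/

namespace FinVectGen.Model

variable {k : Type u} [Field k] {P : PROP.{u}} (M : Model k P)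

open scoped MonObj ComonObj

/-- The morphism `1 ⟶ n` given by multiplication by the vector `x`. -/
def col : ∀ n : ℕ, (Fin n → k) → (P.obj 1 ⟶ P.obj n)
  | 0, _ => M.del
  | n + 1, x => M.dup ≫ (col n (fun i => x i.castSucc) ⊗ₘ M.scale (x (Fin.last n)))

theorem col_one (x : Fin 1 → k) : M.col 1 x = M.scale (x 0) := by
  have h : M.dup ≫ (M.del ▷ P.obj 1) = 𝟙 (P.obj 1) := M.eval_eq .dup_counit
  change M.dup ≫ (M.del ⊗ₘ M.scale (x 0)) = _
  rw [MonoidalCategory.tensorHom_def, reassoc_of% h]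
  exact P.unit_tensor (M.scale (x 0))

/-- `col` splits off one coordinate at a time; coassociativity and the right counit law allow
splitting at any position, which is what tensor products and braidings of terms require. -/
theorem col_add (m : ℕ) : ∀ (n : ℕ) (z : Fin (m + n) → k),
    M.col (m + n) z = M.dup ≫ (M.col m (fstPart z) ⊗ₘ M.col n (sndPart z))
  | 0, z => by
    have h : M.dup ≫ (P.obj 1 ◁ M.del) = 𝟙 (P.obj 1) := M.comonObjOne.comul_counit
    change M.col m z = M.dup ≫ (M.col m z ⊗ₘ M.del)
    rw [MonoidalCategory.tensorHom_def', reassoc_of% h]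
    exact (P.tensor_unit (M.col m z)).symm
  | n + 1, z => by
    change M.dup ≫ (M.col (m + n) _ ⊗ₘ M.scale _) = _
    rw [col_add m n]
    let _ := M.comonObjOne
    refine Eq.trans ?_ (ComonObj.comul_tensor_comul_assoc (M.col m (fstPart z))
      (M.col n (fun i => sndPart z i.castSucc)) (M.scale (sndPart z (Fin.last n))))
    exact congrArg (M.dup ≫ ·) (Category.comp_id _).symm

theorem col_two (x : Fin 2 → k) : M.col 2 x = M.dup ≫ (M.scale (x 0) ⊗ₘ M.scale (x 1)) := by
  rw [← col_one M (fun _ => x 0), ← col_one M (fun _ => x 1), M.col_add 1 1]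
  congr 3 <;> exact funext fun i => by rw [Subsingleton.elim i 0]; rfl

/-- The linear map denoted by a term. -/
abbrev _root_.Term.toLinearMap {m n : ℕ} (t : Term (FinVectGen k) m n) : FinVectMor k m n :=
  Term.eval (P := FinVect k) (FinVectGen.toLinearMap k) t

/-- Each generator is settled by one equation: product, sum and zero of scalars for scaling,
addition and zero; compatibility of scaling with the comonoid for duplication and deletion.
Braidings use cocommutativity. -/
theorem col_eval {m n : ℕ} (t : Term (FinVectGen k) m n) (x : Fin m → k) :
    M.col m x ≫ M.eval t = M.col n (t.toLinearMap x) := by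
  induction t with
  | id n => exact Category.comp_id _
  | braid m n =>
    change _ = M.col (n + m) (Fin.append (sndPart x) (fstPart x))
    rw [col_add, col_add, fstPart_append, sndPart_append, Category.assoc]
    refine (congrArg (M.dup ≫ ·) (BraidedCategory.braiding_naturality _ _)).trans ?_
    exact (reassoc_of% M.dup_comm) _
  | gen s =>
    cases s with
    | scale c =>
      change _ = M.col 1 (fun _ => c * x 0)
      rw [col_one, col_one]
      exact (M.eval_eq (.scale_mul c (x 0))).symm
    | add =>
      change _ = M.col 1 (fun _ => x 0 + x 1)
      rw [col_one, col_two, Category.assoc]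
      exact (M.eval_eq (.scale_add (x 0) (x 1))).symm
    | zero =>
      change _ = M.col 1 (fun _ => 0)
      rw [col_one]
      exact (M.eval_eq .scale_zero).symm
    | dup =>
      change _ = M.col 2 (fun _ => x 0)
      rw [col_one, col_two]
      exact (M.eval_eq (.dup_scale (x 0))).symm
    | del =>
      change _ = M.del
      rw [col_one]
      exact M.eval_eq (.del_scale (x 0))
  | comp f g hf hg =>
    rw [eval_comp, ← Category.assoc, hf, hg]
    rfl
  | tensor f g hf hg =>
    change _ = M.col _ (Fin.append (f.toLinearMap (fstPart x)) (g.toLinearMap (sndPart x)))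
    rw [col_add, col_add, fstPart_append, sndPart_append, ← hf, ← hg, Category.assoc,
      eval_tensor, tensorHom_comp_tensorHom]

/-- The term `0 ⟶ n` denoting the zero map. -/
def zeroTerm (k : Type u) : ∀ n : ℕ, Term (FinVectGen k) 0 n
  | 0 => .id 0
  | n + 1 => ((zeroTerm k n).tensor (FinVectTerm.zero k) : Term (FinVectGen k) (0 + 0) (n + 1))

/-- Expressing the unit by a term makes restriction along it precomposition with a term, so the
induction never leaves values of terms. -/
theorem eval_zeroTerm : ∀ n : ℕ, M.eval (zeroTerm k n) = (M.monObj n).one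
  | 0 => rfl
  | n + 1 => by
    change M.eval (zeroTerm k n) ⊗ₘ M.zero = (λ_ (𝟙_ P.Obj)).inv ≫ ((M.monObj n).one ⊗ₘ M.zero)
    rw [eval_zeroTerm n]
    exact (Category.id_comp _).symm

/-- The value is a monoid morphism on the product of `m` and `1`, hence the sum of its restrictions:
a matrix is its first `m` columns together with its last one. -/
theorem eval_succ {m n : ℕ} (t : Term (FinVectGen k) (m + 1) n) :
    M.eval t =
      (M.eval (Term.comp (m := m) ((Term.id m).tensor (FinVectTerm.zero k)) t) ⊗ₘ
        M.eval (Term.comp (m := 1)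
          ((zeroTerm k m).tensor (Term.id 1) : Term (FinVectGen k) (0 + 1) (m + 1)) t)) ≫
      (M.monObj n).mul := by
  let _ := M.monObj m
  let _ := M.monObjOne
  let _ := M.monObj n
  refine (MonObj.eq_restrict_tensor_restrict_mul (X := P.obj m) (Y := P.obj 1) (M.eval t)
    (M.preserves_eval t).mul_hom).trans ?_
  congr 2
  · exact Category.id_comp _
  · refine (Category.id_comp _).trans ?_
    change ((M.monObj m).one ▷ P.obj 1) ≫ _ = (M.eval (zeroTerm k m) ▷ P.obj 1) ≫ _
    rw [eval_zeroTerm]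
    rfl

theorem eval_eq_of_toLinearMap_eq {n : ℕ} : ∀ {m : ℕ} {t t' : Term (FinVectGen k) m n},
    t.toLinearMap = t'.toLinearMap → M.eval t = M.eval t'
  | 0, t, t', _ => by
    -- With source `0`, preservation of the unit already determines the value.
    have h : ∀ f : Term (FinVectGen k) 0 n, M.eval f = (M.monObj n).one := fun f =>
      (Category.id_comp (M.eval f)).symm.trans (M.preserves_eval f).one_hom
    rw [h, h]
  | m + 1, t, t', h => by
    rw [eval_succ M t, eval_succ M t']
    congr 2
    · refine eval_eq_of_toLinearMap_eq ?_
      exact congrArg (fun f => (FinVect k).comp _ f) h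
    -- The identity of `1` is scaling by `1`, that is, the column of the vector `1`; `col_eval` then
    -- pushes it through the term.
    · have key : ∀ f : Term (FinVectGen k) 1 n, M.eval f = M.col n (f.toLinearMap fun _ => 1) := by
        intro f
        rw [← col_eval, col_one]
        have : M.scale (1 : k) = 𝟙 _ := M.eval_eq .scale_one
        rw [this, Category.id_comp]
      rw [key, key]
      congr 1
      exact congrArg (fun f => (show FinVectMor k 1 n from (FinVect k).comp _ f) fun _ => 1) h

end FinVectGen.Model

/-! ### Linear maps satisfy the equations and are all denoted by terms -/

namespace FinVectGen

variable (k : Type u) [Field k]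

theorem toLinearMap_eq_of_finVectEq {m n : ℕ} {f g : Term (FinVectGen k) m n}
    (h : FinVectEq k m n f g) : f.toLinearMap = g.toLinearMap := by
  refine LinearMap.ext fun x => funext fun i => ?_
  cases h with
  | add_unit =>
    rw [Subsingleton.elim i 0]; exact zero_add (x 0)
  | add_assoc => exact (add_assoc (x 0) (x 1) (x 2)).symm
  | add_comm => exact add_comm (x 1) (x 0)
  | dup_counit => rw [Subsingleton.elim i 0]; rfl
  | dup_coassoc => fin_cases i <;> rfl
  | dup_cocomm => fin_cases i <;> rfl
  | add_dup => fin_cases i <;> rfl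
  | zero_dup => fin_cases i <;> rfl
  | add_del => exact i.elim0
  | zero_del => exact i.elim0
  | scale_mul b c => exact mul_assoc b c (x 0)
  | scale_add b c => exact add_mul b c (x 0)
  | scale_one => rw [Subsingleton.elim i 0]; exact one_mul (x 0)
  | scale_zero => exact zero_mul (x 0)
  | add_scale c => exact (mul_add c (x 0) (x 1)).symm
  | zero_scale c => exact mul_zero c
  | dup_scale c => fin_cases i <;> rfl
  | del_scale c => exact i.elim0

/-- A term denoting multiplication by the vector `x`. -/
def colTerm {k : Type u} : ∀ n : ℕ, (Fin n → k) → Term (FinVectGen k) 1 n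
  | 0, _ => FinVectTerm.del k
  | n + 1, x => (FinVectTerm.dup k).comp
      ((colTerm n fun i => x i.castSucc).tensor (FinVectTerm.scale (x (Fin.last n))))

variable {k}

theorem colTerm_toLinearMap : ∀ (n : ℕ) (x : Fin n → k) (c : Fin 1 → k) (i : Fin n),
    (colTerm n x).toLinearMap c i = x i * c 0
  | 0, _, _, i => i.elim0
  | n + 1, x, c, i => by
    change Fin.append ((colTerm n fun i => x i.castSucc).toLinearMap fun _ => c 0)
      (fun _ => x (Fin.last n) * c 0) i = _
    refine Fin.addCases (fun i => ?_) (fun i => ?_) i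
    · rw [Fin.append_left, colTerm_toLinearMap]; rfl
    · rw [Fin.append_right, Subsingleton.elim i 0]; rfl

variable (k)

/-- A term denoting the addition of vectors. -/
def addTerm : ∀ n : ℕ, Term (FinVectGen k) (n + n) n
  | 0 => Term.id 0
  | n + 1 => Term.comp (n := (n + n) + (1 + 1))
      -- The shuffle `(a, α, b, β) ↦ (a, b, α, β)`, with `a`, `b` of length `n` and `α`, `β` the
      -- last coordinates of the two vectors.
      (recast (Term (FinVectGen k)) (m := n + ((1 + n) + 1)) (n := n + ((n + 1) + 1))
        (by omega) (by omega)
        ((Term.id n).tensor ((Term.braid 1 n).tensor (Term.id 1))))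
      ((addTerm n).tensor (FinVectTerm.add k))

theorem addTerm_toLinearMap : ∀ (n : ℕ) (z : Fin (n + n) → k) (i : Fin n),
    (addTerm k n).toLinearMap z i = fstPart z i + sndPart z i
  | 0, _, i => i.elim0
  | n + 1, z, i => by
    let z' : Fin ((n + n) + (1 + 1)) → k := Fin.append
      (Fin.append (fun i => fstPart z i.castSucc) (fun i => sndPart z i.castSucc))
      (Fin.append (fun _ => fstPart z (Fin.last n)) (fun _ => sndPart z (Fin.last n)))
    have hz : (recast (Term (FinVectGen k)) (m := n + ((1 + n) + 1)) (n := n + ((n + 1) + 1))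
        (m' := (n + 1) + (n + 1)) (n' := (n + n) + (1 + 1)) (by omega) (by omega)
        ((Term.id n).tensor ((Term.braid 1 n).tensor (Term.id 1)))).toLinearMap z = z' := by
      funext i
      rw [Term.toLinearMap, Term.eval_recast]
      refine (FinVectMor.recast_apply k _ _ _ _ _).trans ?_
      let w : Fin (n + ((1 + n) + 1)) → k := fun j => z (Fin.cast (by omega) j)
      change Fin.append (fstPart w) (Fin.append (Fin.append (sndPart (fstPart (sndPart w)))
        (fstPart (fstPart (sndPart w)))) (sndPart (sndPart w))) (Fin.cast _ i) = z' i
      refine Fin.addCases (fun i => ?_) (fun i => ?_) i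
      · refine Eq.trans ?_ (Fin.append_left _ _ i).symm
        refine Fin.addCases (fun i => ?_) (fun i => ?_) i
        · rw [Fin.append_left]
          exact Fin.append_left _ _ i
        · rw [Fin.append_right]
          refine (Fin.append_right _ _ (Fin.castAdd 1 (Fin.castAdd 1 i))).trans ?_
          rw [Fin.append_left, Fin.append_left]
          exact congrArg z (Fin.ext (by simp; omega))
      · refine Eq.trans ?_ (Fin.append_right _ _ i).symm
        refine Fin.addCases (fun i => ?_) (fun i => ?_) i
        · rw [Fin.append_left, Subsingleton.elim i 0]
          refine (Fin.append_right _ _ (Fin.castAdd 1 (Fin.natAdd n 0))).trans ?_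
          rw [Fin.append_left, Fin.append_right]
          exact congrArg z (Fin.ext (by simp))
        · rw [Fin.append_right, Subsingleton.elim i 0]
          refine (Fin.append_right _ _ (Fin.natAdd (n + 1) 0)).trans ?_
          rw [Fin.append_right]
          exact congrArg z (Fin.ext (by simp; omega))
    have h : (addTerm k (n + 1)).toLinearMap z =
        Fin.append ((addTerm k n).toLinearMap (fstPart z')) (fun _ => z' (Fin.natAdd (n + n) 0) +
          z' (Fin.natAdd (n + n) 1)) := by
      rw [← hz]
      rfl
    rw [h]
    refine Fin.addCases (fun i => ?_) (fun i => ?_) i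
    · rw [Fin.append_left, addTerm_toLinearMap n, fstPart_append, fstPart_append, sndPart_append]
      rfl
    · rw [Fin.append_right, Subsingleton.elim i 0]
      exact congrArg₂ (· + ·)
        ((Fin.append_right _ _ 0).trans (Fin.append_left (m := 1) (n := 1) _ _ 0))
        ((Fin.append_right _ _ 1).trans (Fin.append_right (m := 1) (n := 1) _ _ 0))

variable {k}

/-- By linearity `f (x, y) = f (x, 0) + y • f (0, 1)`: the first summand comes from the induction on
`m`, the second from a column, and `addTerm` adds them. -/
theorem exists_toLinearMap_eq {n : ℕ} : ∀ {m : ℕ} (f : FinVectMor k m n),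
    ∃ t : Term (FinVectGen k) m n, t.toLinearMap = f
  | 0, f => ⟨Model.zeroTerm k n, LinearMap.ext fun x => by
      rw [Subsingleton.elim x 0, map_zero, map_zero]⟩
  | m + 1, f => by
    let f₁ : FinVectMor k m n :=
      { toFun := fun x => f (Fin.append x fun _ : Fin 1 => 0)
        map_add' := fun x y => by
          rw [← map_add]; congr 1; funext i
          refine Fin.addCases (fun i => ?_) (fun i => ?_) i <;> simp
        map_smul' := fun c x => by
          rw [← map_smul]; congr 1; funext i
          refine Fin.addCases (fun i => ?_) (fun i => ?_) i <;> simp }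
    obtain ⟨t, ht⟩ := exists_toLinearMap_eq f₁
    refine ⟨(t.tensor (colTerm n (f (Fin.append 0 fun _ : Fin 1 => 1)))).comp (addTerm k n),
      LinearMap.ext fun x => funext fun i => ?_⟩
    refine (addTerm_toLinearMap k n _ i).trans ?_
    have h1 : ∀ y : Fin m → k, t.toLinearMap y = f (Fin.append y fun _ : Fin 1 => 0) := by
      rw [ht]; exact fun _ => rfl
    change fstPart (Fin.append (t.toLinearMap (fstPart x)) ((colTerm n _).toLinearMap
      (sndPart x))) i + sndPart (Fin.append (t.toLinearMap (fstPart x)) ((colTerm n _).toLinearMap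
      (sndPart x))) i = _
    rw [fstPart_append, sndPart_append, h1, colTerm_toLinearMap, mul_comm, ← smul_eq_mul,
      ← Pi.smul_apply, ← map_smul, ← Pi.add_apply, ← map_add]
    refine congrArg (fun y => f y i) (funext fun j => ?_)
    refine Fin.addCases (fun j => ?_) (fun j => ?_) j
    · simp
    · simp [Subsingleton.elim j 0]

end FinVectGen

/-! ### The universal property of the coequalizer -/

theorem FreePROP.eq_lift {S : Signature.{u}} {Q : PROP.{u}} (F : FreePROP S ⟶ Q) :
    F = FreePROP.lift fun {m n} (s : S m n) =>
      PROP.Hom.map F (FreeMor.mk (Term.gen s) : FreeMor S m n) :=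
  (FreePROP.existsUnique_lift _).unique (fun _ => rfl) fun _ => rfl

theorem theorem3p3 (k : Type u) [Field k] :
    IsPresentedBy (FinVect k) (FinVectGen k) (finVectEquations k)
      (FinVectGen.toLinearMap k) := by
  have w : (finVectEquations k).lhs ≫ FreePROP.lift (FinVectGen.toLinearMap k) =
      (finVectEquations k).rhs ≫ FreePROP.lift (FinVectGen.toLinearMap k) :=
    (FreePROP.existsUnique_lift _).unique (fun _ => rfl)
      fun e => (FinVectGen.toLinearMap_eq_of_finVectEq k e.2).symm
  refine ⟨w, ⟨Cofork.IsColimit.mk' _ fun s => ?_⟩⟩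
  let v : ∀ {m n : ℕ}, FinVectGen k m n → s.pt.Mor m n := fun {m n} g =>
    PROP.Hom.map s.π (FreeMor.mk (Term.gen g) : FreeMor _ m n)
  have hπ : s.π = FreePROP.lift v := FreePROP.eq_lift s.π
  have hv : ∀ {m n : ℕ} (f : Term (FinVectGen k) m n),
      PROP.Hom.map s.π (FreeMor.mk f : FreeMor _ m n) = Term.eval v f := fun f => by
    rw [hπ]; rfl
  -- The cofork condition, evaluated at the symbol of an equation, says that the equation holds in
  -- `s.pt`.
  let M : FinVectGen.Model k s.pt :=
    { val := v
      eval_eq := fun {m n f g} h => by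
        rw [← hv, ← hv]
        exact congrArg (fun F : FreePROP (finVectEquations k).signature ⟶ s.pt =>
          PROP.Hom.map F (FreeMor.mk (Term.gen (⟨(f, g), h⟩ : finVectEquations k m n)) :
            FreeMor (finVectEquations k).signature m n)) s.condition }
  choose t ht using fun {m n : ℕ} (f : FinVectMor k m n) => FinVectGen.exists_toLinearMap_eq f
  -- The chosen term may be replaced by any other denoting the same map; this gives functoriality of
  -- `F` although `t` is an arbitrary choice.
  have key : ∀ {m n : ℕ} (f : FinVectMor k m n) (f' : Term (FinVectGen k) m n),
      f'.toLinearMap = f → Term.eval M.val (t f) = Term.eval M.val f' := fun f f' h =>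
    M.eval_eq_of_toLinearMap_eq ((ht f).trans h.symm)
  let F : PROP.Hom (FinVect k) s.pt :=
    { map := fun f => Term.eval M.val (t f)
      map_id := fun n => key _ (Term.id n) rfl
      map_comp := fun f g => key _ ((t f).comp (t g))
        (congrArg₂ (FinVect k).comp (ht f) (ht g))
      map_tensor := fun f g => key _ ((t f).tensor (t g))
        (congrArg₂ (FinVect k).tensor (ht f) (ht g))
      map_braid := fun m n => key _ (Term.braid m n) rfl }
  refine ⟨F, ?_, fun {G} hG => ?_⟩
  · refine Eq.trans ?_ hπ.symm
    exact (FreePROP.existsUnique_lift _).unique (fun g => key _ (Term.gen g) rfl) fun _ => rfl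
  · refine PROP.Hom.ext ?_
    funext m n f
    -- Uniqueness: every linear map is the image of a term, where `G` is forced by the cofork.
    have h := congrArg (fun H : FreePROP (FinVectGen k) ⟶ s.pt =>
      PROP.Hom.map H (FreeMor.mk (t f) : FreeMor _ m n)) hG
    refine Eq.trans ?_ (h.trans (hv (t f)))
    exact congrArg G.map (ht f).symm
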